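/- Setting. Let $\mathcal G$ be a finite directed acyclic graph with vertex set $V$, some of whose vertices are observed and the others latent. A vertex $b$ is a descendant of $a$, and $a$ an ancestor of $b$, if there is a directed path (possibly of length zero) from $a$ to $b$. Each vertex $v$ carries a random variable, also denoted $v$; observed variables are discrete (with countable state spaces), latent ones have arbitrary state spaces. The joint distribution $P$ has density $\prod_{v\in V} f(v\mid \mathrm{pa}_{\mathcal G}(v))$ with respect to a product of $\sigma$-finite measures (counting measures for observed variables), where $f(v\mid \mathrm{pa}_{\mathcal G}(v))$ is a conditional density of $v$ given its parents. The distribution under the intervention $\mathrm{do}(x,d)$, which sets $X=x$ and $D=d$, has the density obtained by deleting from this product the factors of $X$ and of the vertices in $D$ and multiplying by $\mathbb 1_{\{X=x,\,D=d\}}$; $p(y\mid \mathrm{do}(x,d),c)$ is the conditional probability of $Y=y$ given $C=c$ under that distribution. A path (no repeated vertices, edges traversed in either direction) is blocked by $C$ if it has an internal non-collider in $C$ or an internal collider that is not an ancestor of any vertex in $C$; two sets of vertices are d-separated by $C$ if every path between them is blocked by $C$; they are e-separated by $C$ after deletion of $D$ if they are d-separated by $C$ in the induced subgraph on $V\setminus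 D$. Theorem. Suppose that $\mathcal G$ contains the edge $X\to Y$ between observed vertices, and let $C,D$ be sets of observed vertices such that $\{X\},\{Y\},C,D$ are pairwise disjoint and no vertex in $C$ is a descendant of a vertex in $D$. Suppose that in the graph obtained by removing the edge $X\to Y$ from $\mathcal G$, $X$ is e-separated from $Y$ by $C$ after deletion of $D$. Let $$L(x,y,d\mid c)=\max\left\{0,\frac{p(x,y,d\mid c)}{p(x,d\mid c)+1-p(d\mid c)}\right\},\qquad U(x,y,d\mid c)=\min\left\{\frac{p(x,y,d\mid c)+1-p(d\mid c)}{p(x,d\mid c)+1-p(d\mid c)},\,1\right\}.$$ Then, for all values $x,y,d,c$ for which these expressions are well defined (that is, $p(c)>0$, $p(c\mid \mathrm{do}(x,d))>0$ and $p(x,d\mid c)+1-p(d\mid c)>0$), $$L(x,y,d\mid c)\le p(y\mid \mathrm{do}(x,d),c)\le U(x,y,d\mid c).$$ Consequently, for any values $x_0,x_1$ of $X$ and $y_1$ of $Y$ (in particular for binary $X$ and $Y$), the average controlled direct effect $\mathrm{ACDE}_{X\to Y}(d\mid c)=p(y_1\mid \mathrm{do}(x_1,d),c)-p(y_1\mid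 \mathrm{do}(x_0,d),c)$ satisfies, whenever the expressions for $x_0$ and for $x_1$ are well defined, $$L(x_1,y_1,d\mid c)-U(x_0,y_1,d\mid c)\le \mathrm{ACDE}_{X\to Y}(d\mid c)\le U(x_1,y_1,d\mid c)-L(x_0,y_1,d\mid c).$$ If in addition $X$ is not a descendant of any vertex in $D$, then for all values with $p(x,c)>0$ all these expressions are well defined, and the bounds can be strengthened: with $$L'(x,y,d\mid c)=p(y,d\mid x,c),\qquad U'(x,y,d\mid c)=p(y,d\mid x,c)+1-p(d\mid x,c)$$ one has $$L(x,y,d\mid c)\le L'(x,y,d\mid c)\le p(y\mid \mathrm{do}(x,d),c)\le U'(x,y,d\mid c)\le U(x,y,d\mid c),$$ and the bounds on $\mathrm{ACDE}_{X\to Y}(d\mid c)$ hold with $L',U'$ in place of $L,U$ whenever $p(x_0,c)>0$ and $p(x_1,c)>0$. -/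

import Mathlib

open MeasureTheory
open scoped ENNReal

noncomputable section

namespace Digraph

variable {V : Type*}

/-- There is no directed path of positive length from a vertex to itself. -/
def IsDAG (G : Digraph V) : Prop := ∀ v, ¬ Relation.TransGen G.Adj v v

/-- `b` is a descendant of `a`, equivalently `a` is an ancestor of `b`: there is a directed path
from `a` to `b`. The path may have length zero, as usual in the definition of d-separation. -/
def IsDescendant (G : Digraph V) (a b : V) : Prop := Relation.ReflTransGen G.Adj a b

/-- The graph obtained from `G` by removing the edge `X → Y`. -/
def removeEdge (G : Digraph V) (X Y : V) : Digraph V where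
  Adj a b := G.Adj a b ∧ ¬ (a = X ∧ b = Y)

/-- The induced subgraph on a set `W` of vertices. -/
def inducedOn (G : Digraph V) (W : Set V) : Digraph W where
  Adj a b := G.Adj a b

/-- `l` is the list of vertices of a path: consecutive vertices are joined by an edge, in either
direction, and no vertex is repeated. In a DAG two adjacent vertices are joined by exactly one edge,
so that the vertices determine the edges. -/
def IsPath (G : Digraph V) (l : List V) : Prop :=
  l ≠ [] ∧ l.Nodup ∧ l.IsChain (fun a b => G.Adj a b ∨ G.Adj b a)

/-- A path with vertex list `l` is blocked given `C`: some internal vertex `b` of it is a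
non-collider in `C`, or a collider that is not an ancestor of any vertex in `C`. -/
def Blocked (G : Digraph V) (C : Set V) (l : List V) : Prop :=
  ∃ a b c, [a, b, c] <:+: l ∧
    ((¬ (G.Adj a b ∧ G.Adj c b) ∧ b ∈ C) ∨
      ((G.Adj a b ∧ G.Adj c b) ∧ ∀ w ∈ C, ¬ G.IsDescendant b w))

/-- `A` and `B` are d-separated given `C`. -/
def DSep (G : Digraph V) (A B C : Set V) : Prop :=
  ∀ l : List V, G.IsPath l → (∃ a ∈ A, l.head? = some a) → (∃ b ∈ B, l.getLast? = some b) →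
    G.Blocked C l

/-- `A` and `B` are e-separated given `C` after deletion of `D`: they are d-separated given `C` in
the induced subgraph on the complement of `D`. -/
def ESep (G : Digraph V) (A B C D : Set V) : Prop :=
  (G.inducedOn Dᶜ).DSep (Subtype.val ⁻¹' A) (Subtype.val ⁻¹' B) (Subtype.val ⁻¹' C)

end Digraph

/-- A causal model on the directed graph `G`. The vertex `v` carries a random variable with values
in `Ω v`; the vertices in `O` are observed and discrete, the other ones are latent, with
arbitrary state spaces. Here `f v ω` is the conditional density of the variable at `v`, at the
value `ω v`, given that the parents of `v` have the values prescribed by `ω`. -/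
structure CausalModel {V : Type*} [DecidableEq V] (G : Digraph V) (O : Set V)
    (Ω : V → Type*) [∀ v, MeasurableSpace (Ω v)] where
  /-- the reference measures -/
  μ : ∀ v, Measure (Ω v)
  sigmaFinite : ∀ v, SigmaFinite (μ v)
  countable_of_observed : ∀ v ∈ O, Countable (Ω v)
  measurableSingleton_of_observed : ∀ v ∈ O, MeasurableSingletonClass (Ω v)
  count_of_observed : ∀ v ∈ O, μ v = Measure.count
  /-- the conditional densities given the parents -/
  f : V → (∀ u, Ω u) → ℝ≥0∞
  measurable_f : ∀ v, Measurable (f v)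
  dependsOn_f : ∀ v, DependsOn (f v) (insert v {u | G.Adj u v})
  lintegral_f : ∀ v ω, ∫⁻ t, f v (Function.update ω v t) ∂(μ v) = 1

/-- The event that the variables in `S` take the values `s`. -/
def eventEq {V : Type*} {Ω : V → Type*} (S : Finset V) (s : ∀ v : S, Ω v) : Set (∀ v, Ω v) :=
  {ω | ∀ v : S, ω v = s v}

/-- The event that the variable at `X` takes the value `x`. -/
def varEq {V : Type*} {Ω : V → Type*} (X : V) (x : Ω X) : Set (∀ v, Ω v) :=
  {ω | ω X = x}

/-- The conditional probability of the event `A` given the event `B`, as a real number. -/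
def condProb {Ω : Type*} [MeasurableSpace Ω] (P : Measure Ω) (A B : Set Ω) : ℝ :=
  (ProbabilityTheory.cond P B).real A

namespace CausalModel

variable {V : Type*} [Fintype V] [DecidableEq V] {G : Digraph V} {O : Set V}
  {Ω : V → Type*} [∀ v, MeasurableSpace (Ω v)]

/-- The joint distribution `P` of all the variables, with density `∏ f(v | pa(v))`. -/
def joint (M : CausalModel G O Ω) : Measure (∀ v, Ω v) :=
  (Measure.pi M.μ).withDensity (fun ω => ∏ v, M.f v ω)

/-- The distribution of all the variables under the intervention `do(X = x, D = d)`: the factors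
belonging to `X` and to the vertices in `D` are removed from the joint density, which is then
multiplied by the indicator of `{X = x, D = d}`. -/
def doJoint (M : CausalModel G O Ω) (X : V) (D : Finset V) (x : Ω X) (d : ∀ v : D, Ω v) :
    Measure (∀ v, Ω v) :=
  (Measure.pi M.μ).withDensity
    ((varEq X x ∩ eventEq D d).indicator (fun ω => ∏ v ∈ (insert X D)ᶜ, M.f v ω))

/-- `p(y | do(x, d), c)`, the conditional probability of `Y = y` given `C = c` under the
distribution after the intervention. -/
def doProb (M : CausalModel G O Ω) (X Y : V) (C D : Finset V) (x : Ω X) (y : Ω Y)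
    (d : ∀ v : D, Ω v) (c : ∀ v : C, Ω v) : ℝ :=
  condProb (M.doJoint X D x d) (varEq Y y) (eventEq C c)

/-- The average controlled direct effect
`ACDE_{X → Y}(d | c) = p(y₁ | do(x₁, d), c) - p(y₁ | do(x₀, d), c)`. -/
def acde (M : CausalModel G O Ω) (X Y : V) (C D : Finset V) (x₀ x₁ : Ω X) (y₁ : Ω Y)
    (d : ∀ v : D, Ω v) (c : ∀ v : C, Ω v) : ℝ :=
  M.doProb X Y C D x₁ y₁ d c - M.doProb X Y C D x₀ y₁ d c

/-- `p(x, d | c) + 1 - p(d | c)`, the common denominator of the bounds. -/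
def boundDenom (M : CausalModel G O Ω) (X : V) (C D : Finset V) (x : Ω X)
    (d : ∀ v : D, Ω v) (c : ∀ v : C, Ω v) : ℝ :=
  condProb M.joint (varEq X x ∩ eventEq D d) (eventEq C c) + 1
    - condProb M.joint (eventEq D d) (eventEq C c)

/-- `L(x, y, d | c)`. -/
def lowerBound (M : CausalModel G O Ω) (X Y : V) (C D : Finset V) (x : Ω X) (y : Ω Y)
    (d : ∀ v : D, Ω v) (c : ∀ v : C, Ω v) : ℝ :=
  max 0 (condProb M.joint (varEq X x ∩ varEq Y y ∩ eventEq D d) (eventEq C c)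
    / M.boundDenom X C D x d c)

/-- `U(x, y, d | c)`. -/
def upperBound (M : CausalModel G O Ω) (X Y : V) (C D : Finset V) (x : Ω X) (y : Ω Y)
    (d : ∀ v : D, Ω v) (c : ∀ v : C, Ω v) : ℝ :=
  min ((condProb M.joint (varEq X x ∩ varEq Y y ∩ eventEq D d) (eventEq C c) + 1
    - condProb M.joint (eventEq D d) (eventEq C c)) / M.boundDenom X C D x d c) 1

/-- The tighter lower bound `p(y, d | x, c)`. -/
def tightLowerBound (M : CausalModel G O Ω) (X Y : V) (C D : Finset V) (x : Ω X) (y : Ω Y)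
    (d : ∀ v : D, Ω v) (c : ∀ v : C, Ω v) : ℝ :=
  condProb M.joint (varEq Y y ∩ eventEq D d) (varEq X x ∩ eventEq C c)

/-- The tighter upper bound `p(y, d | x, c) + 1 - p(d | x, c)`. -/
def tightUpperBound (M : CausalModel G O Ω) (X Y : V) (C D : Finset V) (x : Ω X) (y : Ω Y)
    (d : ∀ v : D, Ω v) (c : ∀ v : C, Ω v) : ℝ :=
  condProb M.joint (varEq Y y ∩ eventEq D d) (varEq X x ∩ eventEq C c) + 1
    - condProb M.joint (eventEq D d) (varEq X x ∩ eventEq C c)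

/-- All the conditional probabilities and quotients in
`L(x, y, d | c) ≤ p(y | do(x, d), c) ≤ U(x, y, d | c)` are well defined: `p(c) > 0`,
`p(c | do(x, d)) > 0` and `p(x, d | c) + 1 - p(d | c) > 0`. -/
def BoundsDefined (M : CausalModel G O Ω) (X : V) (C D : Finset V) (x : Ω X)
    (d : ∀ v : D, Ω v) (c : ∀ v : C, Ω v) : Prop :=
  M.joint (eventEq C c) ≠ 0 ∧ M.doJoint X D x d (eventEq C c) ≠ 0 ∧ 0 < M.boundDenom X C D x d c

end CausalModel

end

/-!
Let `Q` be the distribution under `do(D = d)`, whose graph has no edges into `D`. Remove `D` and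
the edge `X → Y`, keep only the ancestors of `X`, `Y` and `C`, and let `S` be the set of those
outside of `C` that are joined to `Y` by a walk which is active given `C`. Every remaining factor
of the density which involves variables in `S` only involves those in `S ∪ {X} ∪ C ∪ D`. As `X` is
e-separated from `Y`, its own factor is not among these, so that setting `X = x` instead of
conditioning on it does not matter: `p(y | do(x, d), c) = Q(y | x, c)`.

The density of `Q` on `D = d` arises from that of `P` by removing factors which are at most `1`.
So `P` restricted to `D = d` is dominated by `Q`, and since `C` contains no descendants of `D`,
`Q(c) = P(c)`. Monotonicity of the difference gives
`Q(x, y | c) - p(x, y, d | c) ≤ Q(x | c) - p(x, d | c) ≤ 1 - p(d | c)`, from which the bounds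
follow. If `X` is not a descendant of `D` either, `Q(x | c) = p(x | c)` yields the tighter ones.
-/

namespace CausalGraph

variable {V : Type*} {G H : Digraph V} {C W S T K : Set V} {X Y : V}

/-- The vertex `v` together with its parents: the variables on which the factor of `v` in the
joint density depends. -/
def family (G : Digraph V) (v : V) : Set V := insert v {u | G.Adj u v}

/-- The graph obtained from `G` by removing all the edges into vertices of `K`, as an intervention
on `K` does. -/
def removeInto (G : Digraph V) (K : Set V) : Digraph V where
  Adj a b := G.Adj a b ∧ b ∉ K

/-- The set of all the ancestors of vertices of `W`. -/
def ancestralClosure (G : Digraph V) (W : Set V) : Set V :=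
  {v | ∃ w ∈ W, G.IsDescendant v w}

/-- A set of vertices is ancestral if it contains the parents of its elements. -/
def IsAncestral (G : Digraph V) (W : Set V) : Prop :=
  ∀ v ∈ W, ∀ u, G.Adj u v → u ∈ W

theorem isAncestral_ancestralClosure (G : Digraph V) (W : Set V) :
    IsAncestral G (ancestralClosure G W) :=
  fun _ ⟨w, hw, hvw⟩ _ huv => ⟨w, hw, .head huv hvw⟩

theorem subset_ancestralClosure (G : Digraph V) (W : Set V) : W ⊆ ancestralClosure G W :=
  fun w hw => ⟨w, hw, .refl⟩

theorem IsAncestral.family_subset (hW : IsAncestral G W) {v : V} (hv : v ∈ W) :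
    family G v ⊆ W :=
  Set.insert_subset hv (hW v hv)

theorem isDAG_mono (hG : G.IsDAG) (h : H ≤ G) : H.IsDAG :=
  fun v hv => hG v (Relation.TransGen.mono (fun _ _ hab => h hab) _ _ hv)

theorem removeInto_le (G : Digraph V) (K : Set V) : removeInto G K ≤ G :=
  fun _ _ h => h.1

theorem removeEdge_le (G : Digraph V) (X Y : V) : G.removeEdge X Y ≤ G :=
  fun _ _ h => h.1

theorem family_mono (h : H ≤ G) (v : V) : family H v ⊆ family G v :=
  Set.insert_subset_insert fun _ hu => h hu

theorem isDAG_inducedOn (hG : G.IsDAG) (W : Set V) : (G.inducedOn W).IsDAG :=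
  fun v hv => hG v (hv.lift Subtype.val fun _ _ h => h)

theorem not_adj_of_adj (hG : G.IsDAG) {a b : V} (h : G.Adj a b) : ¬ G.Adj b a :=
  fun h' => hG a (.tail (.single h) h')

theorem ne_of_adj (hG : G.IsDAG) {a b : V} (h : G.Adj a b) : a ≠ b := by
  rintro rfl
  exact hG a (.single h)

theorem exists_mem_forall_mem_not_adj (hG : G.IsDAG) {s : Finset V} (hs : s.Nonempty) :
    ∃ a ∈ s, ∀ b ∈ s, ¬ G.Adj a b := by
  have : IsStrictOrder V (flip (Relation.TransGen G.Adj)) :=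
    { irrefl := hG, trans := fun _ _ _ h₁ h₂ => h₂.trans h₁ }
  obtain ⟨a, -, ha⟩ :=
    (s.finite_toSet.wellFoundedOn (r := flip (Relation.TransGen G.Adj))).has_min Set.univ
      ⟨⟨hs.choose, hs.choose_spec⟩, trivial⟩
  exact ⟨a, a.2, fun b hb hab => ha ⟨b, hb⟩ trivial (.single hab)⟩

/-- An active walk which has reached `v` can be continued to a parent of `v`: here `b` tells
whether the walk enters `v` along an edge pointing to `v`, that is, whether `v` becomes a
collider. -/
def OpenTo (G : Digraph V) (C : Set V) (v : V) (b : Bool) : Prop :=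
  (b = false ∧ v ∉ C) ∨ (b = true ∧ v ∈ ancestralClosure G C)

/-- `ActiveWalk G C Y v l b`: the list `v :: l` is a walk between `v` and `Y`, with possibly
repeated vertices, which is not blocked by `C`, and its edge at `v` points to `v` if and only if
`b` is `true`. -/
inductive ActiveWalk (G : Digraph V) (C : Set V) (Y : V) : V → List V → Bool → Prop
  | nil : ActiveWalk G C Y Y [] false
  | child {v w : V} {l : List V} {b : Bool} :
      ActiveWalk G C Y v l b → v ∉ C → G.Adj v w → ActiveWalk G C Y w (v :: l) true
  | parent {v w : V} {l : List V} {b : Bool} :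
      ActiveWalk G C Y v l b → OpenTo G C v b → G.Adj w v → ActiveWalk G C Y w (v :: l) false

namespace ActiveWalk

variable {v w : V} {l : List V} {b : Bool}

theorem adj_of_cons (h : ActiveWalk G C Y v (w :: l) b) :
    if b then G.Adj w v else G.Adj v w := by
  cases h <;> simpa

theorem isChain (h : ActiveWalk G C Y v l b) :
    (v :: l).IsChain (fun a b => G.Adj a b ∨ G.Adj b a) := by
  induction h with
  | nil => simp
  | child _ _ hvw ih => exact .cons_cons (.inr hvw) ih
  | parent _ _ hwv ih => exact .cons_cons (.inl hwv) ih

theorem getLast?_eq (h : ActiveWalk G C Y v l b) : (v :: l).getLast? = some Y := by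
  induction h <;> simp_all

/-- Where the tail of a walk cannot be continued to a parent, the walk runs from there along
directed edges until it meets a collider. -/
theorem exists_of_mem (h : ActiveWalk G C Y v l b) (hw : w ∈ l) :
    ∃ l' b', ActiveWalk G C Y w l' b' ∧ w :: l' <:+ l ∧
      (OpenTo G C w b' ∨ (b' = true ∧ b = true ∧ G.IsDescendant w v)) := by
  induction h with
  | nil => simp at hw
  | @child v u l b h hv hvu ih =>
    rcases List.mem_cons.1 hw with rfl | hw
    · refine ⟨l, b, h, List.suffix_rfl, ?_⟩
      cases b with
      | false => exact .inl (.inl ⟨rfl, hv⟩)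
      | true => exact .inr ⟨rfl, rfl, .single hvu⟩
    · obtain ⟨l', b', hwalk, hsuffix, hopen⟩ := ih hw
      exact ⟨l', b', hwalk, hsuffix.trans (List.suffix_cons _ _),
        hopen.imp_right fun ⟨hb', _, hwv⟩ => ⟨hb', rfl, hwv.tail hvu⟩⟩
  | @parent v u l b h hv huv ih =>
    rcases List.mem_cons.1 hw with rfl | hw
    · exact ⟨l, b, h, List.suffix_rfl, .inl hv⟩
    · obtain ⟨l', b', hwalk, hsuffix, hopen⟩ := ih hw
      refine ⟨l', b', hwalk, hsuffix.trans (List.suffix_cons _ _), .inl ?_⟩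
      rcases hopen with hopen | ⟨rfl, rfl, hwv⟩
      · exact hopen
      · obtain ⟨-, z, hz, hvz⟩ := hv.resolve_left (by simp)
        exact .inr ⟨rfl, z, hz, hwv.trans hvz⟩

/-- Cutting the loop at a repeated vertex keeps a walk active, because a directed detour which
returns to an ancestor of itself is impossible in a directed acyclic graph. -/
theorem exists_nodup (hG : G.IsDAG) (h : ActiveWalk G C Y v l b) :
    ∃ l' b', ActiveWalk G C Y v l' b' ∧ (v :: l').Nodup ∧
      (OpenTo G C v b → OpenTo G C v b') := by
  induction h with
  | nil => exact ⟨[], false, .nil, by simp, id⟩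
  | @child v w _ _ _ hv hvw ih =>
    obtain ⟨l', b', hwalk, hnodup, -⟩ := ih
    by_cases hw : w ∈ l'
    · obtain ⟨l'', b'', hwalk', hsuffix, hopen⟩ := hwalk.exists_of_mem hw
      refine ⟨l'', b'', hwalk', (List.nodup_cons.1 hnodup).2.sublist hsuffix.sublist, fun hw => ?_⟩
      rcases hopen with hopen | ⟨rfl, -, -⟩
      · exact hopen
      · exact hw
    · exact ⟨v :: l', true, hwalk.child hv hvw,
        hnodup.cons (by simp [(ne_of_adj hG hvw).symm, hw]), id⟩
  | @parent v w _ _ _ hv hwv ih =>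
    obtain ⟨l', b', hwalk, hnodup, hopen⟩ := ih
    by_cases hw : w ∈ l'
    · obtain ⟨l'', b'', hwalk', hsuffix, hopen'⟩ := hwalk.exists_of_mem hw
      refine ⟨l'', b'', hwalk', (List.nodup_cons.1 hnodup).2.sublist hsuffix.sublist, fun _ => ?_⟩
      rcases hopen' with hopen' | ⟨rfl, rfl, -⟩
      · exact hopen'
      · obtain ⟨-, z, hz, hvz⟩ := (hopen hv).resolve_left (by simp)
        exact .inr ⟨rfl, z, hz, .head hwv hvz⟩
    · exact ⟨v :: l', false, hwalk.parent (hopen hv) hwv,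
        hnodup.cons (by simp [ne_of_adj hG hwv, hw]), id⟩

theorem not_blocked_cons {v w : V} {l : List V} (hl : ¬ G.Blocked C (v :: l))
    (hv : ∀ u l', l = u :: l' →
      (G.Adj w v ∧ G.Adj u v → v ∈ ancestralClosure G C) ∧
        (¬ (G.Adj w v ∧ G.Adj u v) → v ∉ C)) :
    ¬ G.Blocked C (w :: v :: l) := by
  rintro ⟨a, b, c, hinfix, hblock⟩
  rcases List.infix_cons_iff.1 hinfix with ⟨l', hl'⟩ | hinfix
  · simp only [List.cons_append, List.nil_append, List.cons.injEq] at hl'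
    obtain ⟨rfl, rfl, hl'⟩ := hl'
    obtain ⟨hcollider, hnoncollider⟩ := hv c l' hl'.symm
    rcases hblock with ⟨hadj, hC⟩ | ⟨hadj, hC⟩
    · exact hnoncollider hadj hC
    · obtain ⟨z, hz, hvz⟩ := hcollider hadj
      exact hC z hz hvz
  · exact hl ⟨a, b, c, hinfix, hblock⟩

theorem not_blocked (hG : G.IsDAG) (h : ActiveWalk G C Y v l b) : ¬ G.Blocked C (v :: l) := by
  induction h with
  | nil =>
    rintro ⟨a, b, c, hinfix, -⟩
    simpa using hinfix.length_le
  | child _ hv hvw ih =>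
    exact not_blocked_cons ih fun u l' _ =>
      ⟨fun hadj => absurd hadj.1 (not_adj_of_adj hG hvw), fun _ => hv⟩
  | @parent v w l b h hv hwv ih =>
    refine not_blocked_cons ih ?_
    rintro u l' rfl
    have hadj := h.adj_of_cons
    rcases hv with ⟨rfl, hv⟩ | ⟨rfl, hv⟩
    · exact ⟨fun huv => absurd huv.2 (not_adj_of_adj hG (by simpa using hadj)), fun _ => hv⟩
    · exact ⟨fun _ => hv, fun hnot => absurd ⟨hwv, by simpa using hadj⟩ hnot⟩

end ActiveWalk

/-- The set of the vertices joined to `Y` by an active walk. -/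
def reachable (G : Digraph V) (C : Set V) (Y : V) : Set V :=
  {v | ∃ l b, ActiveWalk G C Y v l b}

theorem notMem_reachable_of_dSep (hG : G.IsDAG) (hsep : G.DSep {X} {Y} C) :
    X ∉ reachable G C Y := by
  rintro ⟨l, b, h⟩
  obtain ⟨l', b', hwalk, hnodup, -⟩ := h.exists_nodup hG
  exact hwalk.not_blocked hG (hsep (X :: l') ⟨by simp, hnodup, hwalk.isChain⟩ ⟨X, rfl, rfl⟩
    ⟨Y, rfl, hwalk.getLast?_eq⟩)

theorem mem_reachable_of_isDescendant {v w : V} (hv : v ∈ reachable G C Y)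
    (hC : v ∉ ancestralClosure G C) (hvw : G.IsDescendant v w) : w ∈ reachable G C Y := by
  induction hvw with
  | refl => exact hv
  | @tail u w hvu huw ih =>
    obtain ⟨l, b, h⟩ := ih
    exact ⟨u :: l, true, h.child (fun hu => hC ⟨u, hu, hvu⟩) huw⟩

theorem exists_activeWalk_of_isDescendant {v : V} (hC : v ∉ ancestralClosure G C)
    (hvY : G.IsDescendant v Y) : ∃ l, ActiveWalk G C Y v l false := by
  induction hvY using Relation.ReflTransGen.head_induction_on with
  | refl => exact ⟨[], .nil⟩
  | @head v w hvw _ ih =>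
    have hw : w ∉ ancestralClosure G C := fun ⟨z, hz, hwz⟩ => hC ⟨z, hz, .head hvw hwz⟩
    obtain ⟨l, h⟩ := ih hw
    exact ⟨w :: l, h.parent (.inl ⟨rfl, fun hwC => hw (subset_ancestralClosure G C hwC)⟩) hvw⟩

/-- A collider `v` which has no descendant in `C` but is an ancestor of `Y` can be avoided: the
parent is reached by climbing from `Y` through `v`. -/
theorem mem_reachable_of_activeWalk_true (hX : X ∉ reachable G C Y) {v w : V} {l : List V}
    (hv : v ∈ ancestralClosure G (insert X (insert Y C))) (h : ActiveWalk G C Y v l true)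
    (hwv : G.Adj w v) : w ∈ reachable G C Y := by
  by_cases hC : v ∈ ancestralClosure G C
  · exact ⟨v :: l, false, h.parent (.inr ⟨rfl, hC⟩) hwv⟩
  obtain ⟨z, rfl | rfl | hz, hvz⟩ := hv
  · exact absurd (mem_reachable_of_isDescendant ⟨l, true, h⟩ hC hvz) hX
  · obtain ⟨l', h'⟩ := exists_activeWalk_of_isDescendant hC hvz
    exact ⟨v :: l', false,
      h'.parent (.inl ⟨rfl, fun hvC => hC (subset_ancestralClosure G C hvC)⟩) hwv⟩
  · exact absurd ⟨z, hz, hvz⟩ hC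

theorem family_subset_reachable (hX : X ∉ reachable G C Y) {u v : V}
    (hv : v ∈ ancestralClosure G (insert X (insert Y C))) (huv : u ∈ family G v) (hu : u ∉ C)
    (hreach : u ∈ reachable G C Y) : family G v ⊆ reachable G C Y := by
  obtain ⟨l, b, h⟩ := hreach
  rcases huv with rfl | huv
  · refine Set.insert_subset ⟨l, b, h⟩ fun w hw => ?_
    cases b with
    | false => exact ⟨u :: l, false, h.parent (.inl ⟨rfl, hu⟩) hw⟩
    | true => exact mem_reachable_of_activeWalk_true hX hv h hw
  · have hchild := h.child hu huv
    exact Set.insert_subset ⟨_, _, hchild⟩ fun w hw =>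
      mem_reachable_of_activeWalk_true hX hv hchild hw

/-- The families of the vertices of the ancestral set `W` are split by `K`: those of the vertices
of `T` lie in `S ∪ K`, the other ones are disjoint from `S`. The joint density of the variables
in `W` is then a function of the variables in `S ∪ K` times a function of those outside of `S`. -/
structure IsFamilySplit (G : Digraph V) (W S T K : Set V) : Prop where
  isAncestral : IsAncestral G W
  left_subset : S ⊆ W
  factors_subset : T ⊆ W
  separator_subset : K ⊆ W
  disjoint : Disjoint S K
  family_subset : ∀ v ∈ T, family G v ⊆ S ∪ K
  disjoint_family : ∀ v ∈ W, v ∉ T → Disjoint (family G v) S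

theorem exists_isFamilySplit_of_dSep (hG : G.IsDAG) (hsep : G.DSep {X} {Y} C) (hYC : Y ∉ C) :
    ∃ W S T, IsFamilySplit G W S T C ∧ X ∈ W ∧ X ∉ S ∧ Y ∈ S := by
  have hX := notMem_reachable_of_dSep hG hsep
  set W := ancestralClosure G (insert X (insert Y C))
  have hsubset : insert X (insert Y C) ⊆ W := subset_ancestralClosure G _
  have hY : Y ∈ (W ∩ reachable G C Y) \ C := ⟨⟨hsubset (by simp), [], false, .nil⟩, hYC⟩
  refine ⟨W, (W ∩ reachable G C Y) \ C,
    {v ∈ W | ¬ Disjoint (family G v) ((W ∩ reachable G C Y) \ C)},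
    ⟨isAncestral_ancestralClosure G _, fun _ hv => hv.1.1, fun _ hv => hv.1,
      fun _ hv => hsubset (by simp [hv]), Set.disjoint_sdiff_left, ?_, ?_⟩,
    hsubset (by simp), fun h => hX h.1.2, hY⟩
  · rintro v ⟨hvW, hv⟩ w hw
    obtain ⟨u, huv, ⟨-, hreach⟩, hu⟩ := Set.not_disjoint_iff.1 hv
    by_cases hwC : w ∈ C
    · exact .inr hwC
    · exact .inl ⟨⟨(isAncestral_ancestralClosure G _).family_subset hvW hw,
        family_subset_reachable hX hvW huv hu hreach hw⟩, hwC⟩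
  · exact fun v hvW hv => by_contra fun h => hv ⟨hvW, h⟩

namespace IsFamilySplit

theorem mono (h : IsFamilySplit G W S T K) (hle : H ≤ G) : IsFamilySplit H W S T K where
  isAncestral := fun v hv u huv => h.isAncestral v hv u (hle huv)
  left_subset := h.left_subset
  factors_subset := h.factors_subset
  separator_subset := h.separator_subset
  disjoint := h.disjoint
  family_subset := fun v hv => (family_mono hle v).trans (h.family_subset v hv)
  disjoint_family := fun v hv hvT => (h.disjoint_family v hv hvT).mono_left (family_mono hle v)

theorem of_removeEdge (h : IsFamilySplit (G.removeEdge X Y) W S T K) (hXW : X ∈ W)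
    (hXS : X ∉ S) : IsFamilySplit G W S T (insert X K) := by
  have hfamily : ∀ v, family G v ⊆ insert X (family (G.removeEdge X Y) v) := by
    rintro v u (rfl | huv)
    · exact .inr (.inl rfl)
    · by_cases hu : u = X
      · exact .inl hu
      · exact .inr (.inr ⟨huv, fun h => hu h.1⟩)
  refine ⟨fun v hv u huv => ?_, h.left_subset, h.factors_subset,
    Set.insert_subset hXW h.separator_subset, Set.disjoint_insert_right.2 ⟨hXS, h.disjoint⟩,
    fun v hv => ?_, fun v hv hvT => ?_⟩
  · exact Set.insert_subset hXW (h.isAncestral.family_subset hv) (hfamily v (.inr huv))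
  · rw [Set.union_insert]
    exact (hfamily v).trans (Set.insert_subset_insert (h.family_subset v hv))
  · exact (Set.disjoint_insert_left.2 ⟨hXS, h.disjoint_family v hv hvT⟩).mono_left (hfamily v)

theorem of_inducedOn {D : Set V} {W S T K : Set (Dᶜ : Set V)}
    (h : IsFamilySplit (G.inducedOn Dᶜ) W S T K) :
    IsFamilySplit (removeInto G D) (Subtype.val '' W ∪ D) (Subtype.val '' S)
      (Subtype.val '' T) (Subtype.val '' K ∪ D) := by
  have hD : ∀ {R : Set (Dᶜ : Set V)}, Disjoint (Subtype.val '' R) D := by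
    intro R
    exact Set.disjoint_left.2 fun _ ⟨v, _, hv⟩ => hv ▸ v.2
  have hfamily : ∀ v : (Dᶜ : Set V),
      family (removeInto G D) v ⊆ Subtype.val '' family (G.inducedOn Dᶜ) v ∪ D := by
    rintro v u (rfl | ⟨huv, -⟩)
    · exact .inl ⟨v, .inl rfl, rfl⟩
    · by_cases hu : u ∈ D
      · exact .inr hu
      · exact .inl ⟨⟨u, hu⟩, .inr huv, rfl⟩
  refine ⟨?_, (Set.image_mono h.left_subset).trans Set.subset_union_left,
    (Set.image_mono h.factors_subset).trans Set.subset_union_left,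
    Set.union_subset_union_left D (Set.image_mono h.separator_subset),
    Set.disjoint_union_right.2
      ⟨(Set.disjoint_image_iff Subtype.val_injective).2 h.disjoint, hD⟩, ?_, ?_⟩
  · rintro _ (⟨v, hv, rfl⟩ | hv) u huv
    · exact Set.union_subset_union_left D (Set.image_mono (h.isAncestral.family_subset hv))
        (hfamily v (.inr huv))
    · exact absurd hv huv.2
  · rintro _ ⟨v, hv, rfl⟩
    rw [← Set.union_assoc, ← Set.image_union]
    exact (hfamily v).trans (Set.union_subset_union_left D (Set.image_mono (h.family_subset v hv)))
  · rintro _ (⟨v, hv, rfl⟩ | hv) hvT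
    · have hdisj := h.disjoint_family v hv fun hvT' => hvT ⟨v, hvT', rfl⟩
      exact (Set.disjoint_union_left.2
        ⟨(Set.disjoint_image_iff Subtype.val_injective).2 hdisj, hD.symm⟩).mono_left (hfamily v)
    · have hroot : family (removeInto G D) _ ⊆ D :=
        Set.insert_subset hv fun u huv => absurd hv huv.2
      exact hD.symm.mono_left hroot

end IsFamilySplit

theorem removeInto_removeEdge (G : Digraph V) (K : Set V) (X Y : V) :
    removeInto (G.removeEdge X Y) K = (removeInto G K).removeEdge X Y := by
  ext a b
  exact and_right_comm

theorem exists_isFamilySplit_of_eSep {D : Set V} (hG : G.IsDAG)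
    (hsep : (G.removeEdge X Y).ESep {X} {Y} C D) (hXC : X ∉ C) (hXD : X ∉ D) (hYC : Y ∉ C)
    (hYD : Y ∉ D) :
    ∃ W S T, IsFamilySplit (removeInto G D) W S T (insert X (C ∪ D)) ∧ X ∉ T ∧ Y ∈ S := by
  have hsingleton : ∀ v (hv : v ∉ D), (Subtype.val ⁻¹' {v} : Set (Dᶜ : Set V)) = {⟨v, hv⟩} := by
    intro v hv
    ext u
    simp [Subtype.ext_iff]
  rw [Digraph.ESep, hsingleton X hXD, hsingleton Y hYD] at hsep
  obtain ⟨W, S, T, h, hXW, hXS, hYS⟩ := exists_isFamilySplit_of_dSep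
    (isDAG_inducedOn (isDAG_mono hG (removeEdge_le G X Y)) _) hsep hYC
  have hXT : ⟨X, hXD⟩ ∉ T := fun hXT => (h.family_subset _ hXT (.inl rfl)).elim hXS hXC
  have hmem : ∀ {R : Set (Dᶜ : Set V)}, X ∈ Subtype.val '' R ↔ ⟨X, hXD⟩ ∈ R := by simp [hXD]
  have hsplit := h.of_inducedOn
  rw [removeInto_removeEdge, Subtype.image_preimage_coe, Set.inter_comm, ← Set.sdiff_eq,
    Set.sdiff_union_self] at hsplit
  exact ⟨_, _, _, hsplit.of_removeEdge (.inl (hmem.2 hXW)) (mt hmem.1 hXS), mt hmem.1 hXT,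
    ⟨Y, hYD⟩, hYS, rfl⟩

end CausalGraph

section Conditioning

variable {Ω : Type*} [MeasurableSpace Ω] {P Q : Measure Ω} {A B E F : Set Ω}

theorem condProb_eq_div (hB : MeasurableSet B) : condProb P A B = P.real (A ∩ B) / P.real B := by
  rw [condProb, measureReal_def, ProbabilityTheory.cond_apply hB, ENNReal.toReal_mul,
    ENNReal.toReal_inv, Set.inter_comm, ← measureReal_def, ← measureReal_def, inv_mul_eq_div]

theorem condProb_inter_eq_div [IsFiniteMeasure P] (hA : MeasurableSet A) (hB : MeasurableSet B) :
    condProb P E (A ∩ B) = condProb P (A ∩ E) B / condProb P A B := by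
  rw [Set.inter_comm A B, condProb, ← ProbabilityTheory.cond_cond_eq_cond_inter hB hA,
    Set.inter_comm A E]
  exact condProb_eq_div hA

theorem condProb_nonneg : 0 ≤ condProb P A B := measureReal_nonneg

theorem condProb_pos [IsFiniteMeasure P] (hB : MeasurableSet B) (h : P (A ∩ B) ≠ 0) :
    0 < condProb P A B :=
  ENNReal.toReal_pos
    (ProbabilityTheory.cond_pos_of_inter_ne_zero hB (by rwa [Set.inter_comm])).ne'
    (measure_ne_top _ _)

theorem condProb_le_one : condProb P A B ≤ 1 := measureReal_le_one

theorem condProb_mono (h : A ⊆ B) : condProb P A E ≤ condProb P B E := measureReal_mono h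

theorem real_sub_le_real_sub [IsFiniteMeasure P] [IsFiniteMeasure Q] (hPQ : P ≤ Q) (hEF : E ⊆ F) :
    Q.real E - P.real E ≤ Q.real F - P.real F := by
  have hadd (S : Set Ω) : (Q - P).real S + P.real S = Q.real S := by
    rw [← measureReal_add_apply, Measure.sub_add_cancel_of_le hPQ]
  linarith [hadd E, hadd F, measureReal_mono hEF (μ := Q - P)]

theorem restrict_cond_le_cond (hA : MeasurableSet A) (hB : MeasurableSet B)
    (h : P.restrict A ≤ Q) (hPQ : P B = Q B) :
    (ProbabilityTheory.cond P B).restrict A ≤ ProbabilityTheory.cond Q B := by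
  rw [ProbabilityTheory.cond, ProbabilityTheory.cond, Measure.restrict_smul,
    Measure.restrict_restrict hA, Set.inter_comm, ← Measure.restrict_restrict hB, hPQ]
  gcongr

theorem add_sub_div_le_add_sub_div {a b s t : ℝ} (hab : a ≤ b) (hs : 0 < s) (hst : s ≤ t) :
    (a + (s - b)) / s ≤ (a + (t - b)) / t := by
  have h (u : ℝ) (hu : u ≠ 0) : (a + (u - b)) / u = 1 - (b - a) / u := by
    field_simp
    ring
  rw [h s hs.ne', h t (hs.trans_le hst).ne']
  gcongr

variable {t z : ℝ}

theorem real_div_le [IsFiniteMeasure Q] (hPQ : P ≤ Q) (ht : Q.real A ≤ t) (htpos : 0 < t)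
    (hz : 0 ≤ z) (hzQ : z * Q.real A = Q.real E) : P.real E / t ≤ z := by
  rw [div_le_iff₀ htpos]
  calc P.real E
      ≤ Q.real E := ENNReal.toReal_mono (measure_ne_top Q E) (hPQ E)
    _ = z * Q.real A := hzQ.symm
    _ ≤ z * t := by gcongr

theorem le_real_add_div [IsFiniteMeasure P] [IsFiniteMeasure Q] (hPQ : P ≤ Q) (hEA : E ⊆ A)
    (ht : Q.real A ≤ t) (htpos : 0 < t) (hz : z ≤ 1) (hzQ : z * Q.real A = Q.real E) :
    z ≤ (P.real E + (t - P.real A)) / t := by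
  rw [le_div_iff₀ htpos]
  calc z * t
      = z * Q.real A + z * (t - Q.real A) := by ring
    _ ≤ Q.real E + 1 * (t - Q.real A) := by rw [hzQ]; gcongr
    _ ≤ P.real E + (t - P.real A) := by linarith [real_sub_le_real_sub hPQ hEA]

end Conditioning

section EventEq

variable {V : Type*} {Ω : V → Type*}

theorem eventEq_eq_iInter (S : Finset V) (s : ∀ v : S, Ω v) :
    eventEq S s = ⋂ v : S, varEq (Ω := Ω) v (s v) := by
  ext ω
  simp [eventEq, varEq]

theorem eventEq_singleton (X : V) (x : Ω X) :
    eventEq {X} (uniqueElim x : ∀ v : ({X} : Finset V), Ω v) = varEq X x :=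
  Set.ext fun _ => Unique.forall_iff

theorem eventEq_insert_union [DecidableEq V] {X : V} {C D : Finset V} (ω : ∀ v, Ω v) :
    eventEq (insert X (C ∪ D)) (Finset.restrict _ ω)
      = varEq X (ω X) ∩ (eventEq C (C.restrict ω) ∩ eventEq D (D.restrict ω)) := by
  ext ω'
  simp [eventEq, varEq, or_imp, forall_and]

theorem eq_restrict_of_mem_eventEq {S : Finset V} {s : ∀ v : S, Ω v} {ω : ∀ v, Ω v}
    (h : ω ∈ eventEq S s) : s = S.restrict ω :=
  funext fun v => (h v).symm

theorem dependsOn_mem_eventEq (S : Finset V) (s : ∀ v : S, Ω v) :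
    DependsOn (· ∈ eventEq S s) (S : Set V) := fun ω ω' h => by
  simp only [eventEq, Set.mem_ofPred_eq]
  exact propext (forall_congr' fun v => by rw [h v v.2])

theorem dependsOn_mem_varEq (X : V) (x : Ω X) : DependsOn (· ∈ varEq X x) {X} := fun ω ω' h => by
  simp only [varEq, Set.mem_ofPred_eq, h X rfl]

theorem dependsOn_mem_inter {E F : Set (∀ v, Ω v)} {s : Set V} (hE : DependsOn (· ∈ E) s)
    (hF : DependsOn (· ∈ F) s) : DependsOn (· ∈ E ∩ F) s := fun _ _ h =>
  propext (and_congr (hE h).to_iff (hF h).to_iff)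

end EventEq

section LMarginal

variable {V : Type*} {Ω : V → Type*} {f g : (∀ v, Ω v) → ℝ≥0∞} {s t : Set V}

theorem dependsOn_indicator {E : Set (∀ v, Ω v)} (hE : DependsOn (· ∈ E) s)
    (hf : DependsOn f s) : DependsOn (E.indicator f) s := fun ω ω' h => by
  classical
  rw [Set.indicator_apply, Set.indicator_apply, hf h]
  exact if_congr (hE h).to_iff rfl rfl

variable [DecidableEq V] [∀ v, MeasurableSpace (Ω v)] {μ : ∀ v, Measure (Ω v)}

theorem lmarginal_mul_of_dependsOn_compl {s : Finset V} (hf : DependsOn f (s : Set V)ᶜ)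
    (hg : Measurable g) : ∫⋯∫⁻_s, f * g ∂μ = f * ∫⋯∫⁻_s, g ∂μ := by
  funext ω
  have hf' : ∀ z : ∀ v : s, Ω v, f (Function.updateFinset ω s z) = f ω := fun z =>
    hf fun v hv => dif_neg hv
  simp only [lmarginal, Pi.mul_apply, hf']
  exact lintegral_const_mul _ (hg.comp measurable_updateFinset)

theorem dependsOn_lmarginal {s : Finset V} (hf : DependsOn f (s ∪ t)) :
    DependsOn (∫⋯∫⁻_s, f ∂μ) t := by
  refine fun ω ω' h => lintegral_congr fun z => hf.updateFinset z fun v hv => h v ?_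
  exact hv.1.resolve_left hv.2

end LMarginal

namespace CausalModel

open CausalGraph

variable {V : Type*} [DecidableEq V] {G : Digraph V} {O : Set V}
  {Ω : V → Type*} [∀ v, MeasurableSpace (Ω v)] (M : CausalModel G O Ω)

instance (v : V) : SigmaFinite (M.μ v) := M.sigmaFinite v

theorem measurableSet_varEq (M : CausalModel G O Ω) {v : V} (hv : v ∈ O) (x : Ω v) :
    MeasurableSet (varEq v x) :=
  have := M.measurableSingleton_of_observed v hv
  measurable_pi_apply v (measurableSet_singleton x)

theorem measurableSet_eventEq (M : CausalModel G O Ω) {S : Finset V} (hS : (S : Set V) ⊆ O)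
    (s : ∀ v : S, Ω v) : MeasurableSet (eventEq S s) := by
  rw [eventEq_eq_iInter]
  exact .iInter fun v => M.measurableSet_varEq (hS v.2) (s v)

theorem f_le_one {v : V} (hv : v ∈ O) (ω : ∀ v, Ω v) : M.f v ω ≤ 1 := by
  have := M.measurableSingleton_of_observed v hv
  calc M.f v ω
      = M.f v (Function.update ω v (ω v)) := by rw [Function.update_eq_self]
    _ ≤ ∑' t, M.f v (Function.update ω v t) := ENNReal.le_tsum (ω v)
    _ = 1 := by rw [← lintegral_count, ← M.count_of_observed v hv, M.lintegral_f]

/-- The product of the conditional densities of the variables in `T` given their parents. -/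
noncomputable def density (T : Finset V) (ω : ∀ v, Ω v) : ℝ≥0∞ := ∏ v ∈ T, M.f v ω

@[fun_prop]
theorem measurable_density (T : Finset V) : Measurable (M.density T) :=
  Finset.measurable_fun_prod T fun v _ => M.measurable_f v

theorem dependsOn_density {T : Finset V} {R : Set V} (h : ∀ v ∈ T, family G v ⊆ R) :
    DependsOn (M.density T) R := fun _ _ hω =>
  Finset.prod_congr rfl fun v hv => M.dependsOn_f v fun u hu => hω u (h v hv hu)

theorem density_sdiff_mul_density {T R : Finset V} (h : T ⊆ R) :
    M.density (R \ T) * M.density T = M.density R :=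
  funext fun _ => Finset.prod_sdiff h

/-- Children are integrated out before their parents. -/
theorem lmarginal_density (hG : G.IsDAG) (T : Finset V) : ∫⋯∫⁻_T, M.density T ∂M.μ = 1 := by
  induction T using Finset.strongInduction with
  | H T ih =>
  rcases T.eq_empty_or_nonempty with rfl | hT
  · rw [lmarginal_empty]
    rfl
  obtain ⟨a, ha, hsink⟩ := exists_mem_forall_mem_not_adj hG hT
  have hrest : DependsOn (M.density (T.erase a)) {a}ᶜ := by
    refine M.dependsOn_density fun v hv => ?_
    rw [Set.subset_compl_singleton_iff, family]
    rintro (rfl | hav)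
    · exact Finset.notMem_erase _ _ hv
    · exact hsink v (Finset.mem_of_mem_erase hv) hav
  have hfactor : M.density T = M.density (T.erase a) * M.f a :=
    funext fun ω => (Finset.prod_erase_mul T (M.f · ω) ha).symm
  have hmarginal : ∫⋯∫⁻_{a}, M.density T ∂M.μ = M.density (T.erase a) := by
    rw [hfactor, lmarginal_mul_of_dependsOn_compl (by simpa using hrest) (M.measurable_f a),
      lmarginal_singleton]
    simp [M.lintegral_f, ← Pi.one_def]
  rw [← Finset.sdiff_union_of_subset (Finset.singleton_subset_iff.2 ha),
    lmarginal_union _ _ (M.measurable_density _) Finset.sdiff_disjoint,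
    Finset.sdiff_union_of_subset (Finset.singleton_subset_iff.2 ha), hmarginal,
    ← Finset.erase_eq, ih _ (Finset.erase_ssubset ha)]

section Intervene

variable {S : Finset V} (hS : (S : Set V) ⊆ O) (s : ∀ v : S, Ω v)

/-- The model after the intervention which sets the variables in `S` to the values `s`. The
conditional densities of these variables become indicators, so that they have no parents. -/
noncomputable def intervene : CausalModel (removeInto G S) O Ω where
  μ := M.μ
  sigmaFinite := M.sigmaFinite
  countable_of_observed := M.countable_of_observed
  measurableSingleton_of_observed := M.measurableSingleton_of_observed
  count_of_observed := M.count_of_observed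
  f v := if h : v ∈ S then (varEq v (s ⟨v, h⟩)).indicator 1 else M.f v
  measurable_f v := by
    split_ifs with h
    · exact measurable_one.indicator (M.measurableSet_varEq (hS h) _)
    · exact M.measurable_f v
  dependsOn_f v := by
    split_ifs with h
    · exact dependsOn_indicator ((dependsOn_mem_varEq v _).mono (by simp)) fun _ _ _ => rfl
    · exact (M.dependsOn_f v).mono (Set.insert_subset_insert fun u hu => ⟨hu, h⟩)
  lintegral_f v ω := by
    split_ifs with h
    · have := M.measurableSingleton_of_observed v (hS h)
      have hindicator : ∀ t, (varEq v (s ⟨v, h⟩)).indicator (1 : (∀ v, Ω v) → ℝ≥0∞)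
          (Function.update ω v t) = ({s ⟨v, h⟩} : Set (Ω v)).indicator 1 t := fun t => by
        classical simp only [Set.indicator_apply, varEq, Set.mem_ofPred_eq, Function.update_self,
          Set.mem_singleton_iff, Pi.one_apply]
      simp only [hindicator]
      rw [lintegral_indicator_one (measurableSet_singleton _), M.count_of_observed v (hS h),
        Measure.count_singleton]
    · exact M.lintegral_f v ω

theorem intervene_μ : (M.intervene hS s).μ = M.μ := rfl

theorem intervene_f_of_mem {v : V} (hv : v ∈ S) :
    (M.intervene hS s).f v = (varEq v (s ⟨v, hv⟩)).indicator 1 :=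
  dif_pos hv

theorem intervene_f_of_notMem {v : V} (hv : v ∉ S) : (M.intervene hS s).f v = M.f v :=
  dif_neg hv

theorem density_intervene_of_disjoint {T : Finset V} (hST : Disjoint S T) :
    (M.intervene hS s).density T = M.density T :=
  funext fun ω => Finset.prod_congr rfl fun v hv => by
    rw [M.intervene_f_of_notMem hS s (Finset.disjoint_right.1 hST hv)]

theorem density_intervene_self :
    (M.intervene hS s).density S = (eventEq S s).indicator 1 := by
  funext ω
  by_cases hω : ω ∈ eventEq S s
  · rw [Set.indicator_of_mem hω]
    refine Finset.prod_eq_one fun v hv => ?_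
    rw [M.intervene_f_of_mem hS s hv, Set.indicator_of_mem (by exact hω ⟨v, hv⟩), Pi.one_apply]
  · rw [Set.indicator_of_notMem hω]
    obtain ⟨v, hv⟩ := not_forall.1 hω
    refine Finset.prod_eq_zero v.2 ?_
    rw [M.intervene_f_of_mem hS s v.2, Set.indicator_of_notMem (by exact hv)]

theorem density_intervene_of_subset {T : Finset V} (hST : S ⊆ T) :
    (M.intervene hS s).density T = (eventEq S s).indicator (M.density (T \ S)) := by
  rw [← density_sdiff_mul_density _ hST, M.density_intervene_self,
    M.density_intervene_of_disjoint hS s Finset.disjoint_sdiff]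
  funext ω
  classical simp [Set.indicator_apply]

variable [Fintype V]

theorem joint_intervene : (M.intervene hS s).joint
    = ((Measure.pi M.μ).restrict (eventEq S s)).withDensity (M.density Sᶜ) := by
  rw [← withDensity_indicator (M.measurableSet_eventEq hS s), Finset.compl_eq_univ_sdiff,
    ← M.density_intervene_of_subset hS s (Finset.subset_univ S)]
  rfl

theorem joint_intervene_restrict :
    (M.intervene hS s).joint.restrict (eventEq S s) = (M.intervene hS s).joint := by
  rw [M.joint_intervene hS s, restrict_withDensity (M.measurableSet_eventEq hS s),
    Measure.restrict_restrict (M.measurableSet_eventEq hS s), Set.inter_self]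

theorem restrict_joint_le_joint_intervene :
    M.joint.restrict (eventEq S s) ≤ (M.intervene hS s).joint := by
  rw [M.joint_intervene hS s, joint, restrict_withDensity (M.measurableSet_eventEq hS s)]
  refine withDensity_mono (.of_forall fun ω => ?_)
  exact Finset.prod_le_prod_of_subset_of_le_one' (Finset.subset_univ _)
    fun v _ hv => M.f_le_one (hS (by simpa using hv)) ω

end Intervene

section Joint

variable [Fintype V]

theorem joint_eq_lmarginal (hG : G.IsDAG) {W : Finset V} (hW : IsAncestral G W)
    {E : Set (∀ v, Ω v)} (hE : MeasurableSet E) (hEW : DependsOn (· ∈ E) (W : Set V))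
    (ω : ∀ v, Ω v) : M.joint E = (∫⋯∫⁻_W, E.indicator (M.density W) ∂M.μ) ω := by
  have hmeasurable : Measurable (E.indicator (M.density W)) :=
    (M.measurable_density W).indicator hE
  have hdepends : DependsOn (E.indicator (M.density W)) ((Wᶜ : Finset V) : Set V)ᶜ := by
    rw [Finset.coe_compl, compl_compl]
    exact dependsOn_indicator hEW (M.dependsOn_density fun v hv => hW.family_subset hv)
  have hfactor : E.indicator (M.density Finset.univ)
      = E.indicator (M.density W) * M.density Wᶜ := by
    rw [← density_sdiff_mul_density M W.subset_univ, ← Finset.compl_eq_univ_sdiff, mul_comm]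
    exact funext fun ω' => Set.indicator_mul_left E _ _
  calc M.joint E
      = ∫⁻ ω', E.indicator (M.density Finset.univ) ω' ∂Measure.pi M.μ := by
        rw [lintegral_indicator hE, joint, withDensity_apply _ hE]
        rfl
    _ = (∫⋯∫⁻_W ∪ Wᶜ, E.indicator (M.density W) * M.density Wᶜ ∂M.μ) ω := by
        rw [lintegral_eq_lmarginal_univ ω, hfactor, Finset.union_compl]
    _ = (∫⋯∫⁻_W, E.indicator (M.density W) ∂M.μ) ω := by
        rw [lmarginal_union _ _ (hmeasurable.mul (M.measurable_density _)) disjoint_compl_right,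
          lmarginal_mul_of_dependsOn_compl hdepends (by fun_prop), M.lmarginal_density hG, mul_one]

theorem joint_univ_le_one (hG : G.IsDAG) : M.joint Set.univ ≤ 1 := by
  rcases isEmpty_or_nonempty (∀ v, Ω v) with h | ⟨⟨ω⟩⟩
  · simp [Set.univ_eq_empty_iff.2 h]
  · rw [M.joint_eq_lmarginal hG (W := Finset.univ) (fun _ _ u _ => Finset.mem_univ u) .univ
      (fun _ _ _ => rfl) ω, Set.indicator_univ, M.lmarginal_density hG, Pi.one_apply]

theorem isFiniteMeasure_joint (hG : G.IsDAG) : IsFiniteMeasure M.joint :=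
  ⟨(M.joint_univ_le_one hG).trans_lt ENNReal.one_lt_top⟩

theorem joint_intervene_of_not_isDescendant (hG : G.IsDAG) {S : Finset V}
    (hS : (S : Set V) ⊆ O) (s : ∀ v : S, Ω v) {N : Set V}
    (hN : ∀ a ∈ S, ∀ b ∈ N, ¬ G.IsDescendant a b) {E : Set (∀ v, Ω v)} (hE : MeasurableSet E)
    (hEN : DependsOn (· ∈ E) N) : (M.intervene hS s).joint E = M.joint E := by
  classical
  rcases E.eq_empty_or_nonempty with rfl | ⟨ω, -⟩
  · simp
  set W : Finset V := {v | ∀ a ∈ S, ¬ G.IsDescendant a v} with hWdef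
  have hmem : ∀ v, v ∈ W ↔ ∀ a ∈ S, ¬ G.IsDescendant a v := by simp [hWdef]
  have hW : IsAncestral G (W : Set V) := fun v hv u huv =>
    (hmem u).2 fun a ha hau => (hmem v).1 hv a ha (hau.tail huv)
  have hdisj : Disjoint S W := Finset.disjoint_left.2 fun v hvS hvW => (hmem v).1 hvW v hvS .refl
  have hEW : DependsOn (· ∈ E) (W : Set V) :=
    hEN.mono fun b hb => (hmem b).2 fun a ha => hN a ha b hb
  rw [M.joint_eq_lmarginal hG hW hE hEW ω,
    joint_eq_lmarginal _ (isDAG_mono hG (removeInto_le G S))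
      (fun v hv u huv => hW v hv u huv.1) hE hEW ω,
    M.density_intervene_of_disjoint hS s hdisj]
  rfl

/-- The densities of the vertices of `T` only involve variables in `S` and in `K`, the values of
the latter being given; so the integrals over `S` and over `W \ S` separate. -/
theorem joint_inter_eventEq (hG : G.IsDAG) {W S T K : Finset V}
    (hsplit : IsFamilySplit G (W : Set V) S T K) (hK : (K : Set V) ⊆ O)
    {E : Set (∀ v, Ω v)} (hE : MeasurableSet E) (hES : DependsOn (· ∈ E) (S : Set V))
    (ω : ∀ v, Ω v) :
    M.joint (E ∩ eventEq K (K.restrict ω))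
      = (∫⋯∫⁻_S, E.indicator (M.density T) ∂M.μ) ω
        * (∫⋯∫⁻_W \ S, (eventEq K (K.restrict ω)).indicator (M.density (W \ T)) ∂M.μ) ω := by
  set F := eventEq K (K.restrict ω)
  set φ := E.indicator (M.density T)
  set ψ := F.indicator (M.density (W \ T)) with hψdef
  have hF : MeasurableSet F := M.measurableSet_eventEq hK _
  have hFK : DependsOn (· ∈ F) (K : Set V) := dependsOn_mem_eventEq K _
  have hφ : Measurable φ := (M.measurable_density T).indicator hE
  have hψ : Measurable ψ := (M.measurable_density _).indicator hF
  have hφK : DependsOn (∫⋯∫⁻_S, φ ∂M.μ) (K : Set V) := dependsOn_lmarginal <|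
    dependsOn_indicator (hES.mono Set.subset_union_left)
      (M.dependsOn_density hsplit.family_subset)
  have hψS : DependsOn ψ (S : Set V)ᶜ := by
    refine dependsOn_indicator (hFK.mono hsplit.disjoint.subset_compl_left)
      (M.dependsOn_density fun v hv => ?_)
    obtain ⟨hvW, hvT⟩ := Finset.mem_sdiff.1 hv
    exact (hsplit.disjoint_family v hvW hvT).subset_compl_right
  have hEFW : DependsOn (· ∈ E ∩ F) (W : Set V) := dependsOn_mem_inter
    (hES.mono hsplit.left_subset) (hFK.mono hsplit.separator_subset)
  have hfactor : (E ∩ F).indicator (M.density W) = ψ * φ := by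
    rw [← density_sdiff_mul_density M (Finset.coe_subset.1 hsplit.factors_subset),
      Set.inter_comm]
    exact funext fun ω' => Set.inter_indicator_mul _ _ ω'
  have hconst : ψ * ∫⋯∫⁻_S, φ ∂M.μ = (fun _ => (∫⋯∫⁻_S, φ ∂M.μ) ω) * ψ := by
    funext ω'
    by_cases hω' : ω' ∈ F
    · rw [Pi.mul_apply, Pi.mul_apply, hφK fun v hv => hω' ⟨v, hv⟩, mul_comm]
    · simp [hψdef, hω']
  rw [M.joint_eq_lmarginal hG hsplit.isAncestral (hE.inter hF) hEFW ω, hfactor,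
    ← Finset.sdiff_union_of_subset (Finset.coe_subset.1 hsplit.left_subset),
    lmarginal_union _ _ (hψ.mul hφ) Finset.sdiff_disjoint,
    lmarginal_mul_of_dependsOn_compl hψS hφ, hconst,
    lmarginal_mul_of_dependsOn_compl (fun _ _ _ => rfl) hψ,
    Finset.sdiff_union_of_subset (Finset.coe_subset.1 hsplit.left_subset)]
  rfl

/-- Only the factors of the vertices of `T` affect the distribution of the variables in `S` given
those in `K`, and an intervention outside of `T` preserves these factors. Without divisions,
this is the equality of the conditional probabilities of `E`. -/
theorem joint_inter_mul_joint_intervene (hG : G.IsDAG) {W S T K L : Finset V}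
    (hsplit : IsFamilySplit G (W : Set V) S T K) (hK : (K : Set V) ⊆ O) (κ : ∀ v : K, Ω v)
    (hL : (L : Set V) ⊆ O) (hLT : Disjoint L T) (ℓ : ∀ v : L, Ω v) {E : Set (∀ v, Ω v)}
    (hE : MeasurableSet E) (hES : DependsOn (· ∈ E) (S : Set V)) :
    M.joint (E ∩ eventEq K κ) * (M.intervene hL ℓ).joint (eventEq K κ)
      = M.joint (eventEq K κ) * (M.intervene hL ℓ).joint (E ∩ eventEq K κ) := by
  obtain hempty | ⟨ω, hω⟩ := (eventEq K κ).eq_empty_or_nonempty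
  · simp [hempty]
  obtain rfl := eq_restrict_of_mem_eventEq hω
  have hG' := isDAG_mono hG (removeInto_le G L)
  have hsplit' := hsplit.mono (removeInto_le G L)
  have hT : (M.intervene hL ℓ).density T = M.density T := M.density_intervene_of_disjoint hL ℓ hLT
  have huniv : DependsOn (· ∈ (Set.univ : Set (∀ v, Ω v))) (S : Set V) := fun _ _ _ => rfl
  rw [← Set.univ_inter (eventEq K _), ← Set.inter_assoc, Set.inter_univ,
    M.joint_inter_eventEq hG hsplit hK hE hES, M.joint_inter_eventEq hG hsplit hK .univ huniv,
    joint_inter_eventEq _ hG' hsplit' hK hE hES, joint_inter_eventEq _ hG' hsplit' hK .univ huniv,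
    hT, M.intervene_μ hL ℓ]
  ring

theorem doJoint_eq_joint_intervene {X : V} {D : Finset V} (hXO : X ∈ O) (hDO : (D : Set V) ⊆ O)
    (hXD : X ∉ D) (x : Ω X) (d : ∀ v : D, Ω v) : M.doJoint X D x d
      = ((M.intervene hDO d).intervene (S := {X}) (by simpa) (uniqueElim x)).joint := by
  have hsdiff : (insert X D)ᶜ = ({X} : Finset V)ᶜ \ D := by
    ext v
    simp
  rw [joint_intervene, eventEq_singleton, intervene_μ,
    density_intervene_of_subset _ _ _ (by rwa [Finset.subset_compl_singleton]),
    ← withDensity_indicator (M.measurableSet_varEq hXO x), Set.indicator_indicator, ← hsdiff]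
  rfl

theorem doJoint_restrict {X : V} {D : Finset V} (hXO : X ∈ O) (hDO : (D : Set V) ⊆ O)
    (x : Ω X) (d : ∀ v : D, Ω v) :
    (M.doJoint X D x d).restrict (varEq X x ∩ eventEq D d) = M.doJoint X D x d := by
  have hXD := (M.measurableSet_varEq hXO x).inter (M.measurableSet_eventEq hDO d)
  rw [doJoint, withDensity_indicator hXD, restrict_withDensity hXD,
    Measure.restrict_restrict hXD, Set.inter_self]

theorem restrict_joint_intervene_le_doJoint {X : V} {D : Finset V} (hXO : X ∈ O)
    (hDO : (D : Set V) ⊆ O) (hXD : X ∉ D) (x : Ω X) (d : ∀ v : D, Ω v) :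
    (M.intervene hDO d).joint.restrict (varEq X x) ≤ M.doJoint X D x d := by
  rw [M.doJoint_eq_joint_intervene hXO hDO hXD, ← eventEq_singleton]
  exact restrict_joint_le_joint_intervene _ _ _

theorem isFiniteMeasure_doJoint (hG : G.IsDAG) {X : V} {D : Finset V} (hXO : X ∈ O)
    (hDO : (D : Set V) ⊆ O) (hXD : X ∉ D) (x : Ω X) (d : ∀ v : D, Ω v) :
    IsFiniteMeasure (M.doJoint X D x d) := by
  rw [M.doJoint_eq_joint_intervene hXO hDO hXD]
  exact isFiniteMeasure_joint _
    (isDAG_mono hG ((removeInto_le _ _).trans (removeInto_le _ _)))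

theorem joint_intervene_mul_doJoint (hG : G.IsDAG) {X Y : V} {C D : Finset V}
    (hXO : X ∈ O) (hYO : Y ∈ O) (hCO : (C : Set V) ⊆ O) (hDO : (D : Set V) ⊆ O)
    (hXC : X ∉ C) (hXD : X ∉ D) (hYC : Y ∉ C) (hYD : Y ∉ D)
    (hsep : (G.removeEdge X Y).ESep {X} {Y} C D)
    (x : Ω X) (y : Ω Y) (d : ∀ v : D, Ω v) (c : ∀ v : C, Ω v) :
    (M.intervene hDO d).joint (varEq X x ∩ varEq Y y ∩ eventEq C c)
        * M.doJoint X D x d (eventEq C c)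
      = (M.intervene hDO d).joint (varEq X x ∩ eventEq C c)
        * M.doJoint X D x d (varEq Y y ∩ eventEq C c) := by
  have hX := M.measurableSet_varEq hXO x
  have hY := M.measurableSet_varEq hYO y
  have hC := M.measurableSet_eventEq hCO c
  set F := varEq X x ∩ (eventEq C c ∩ eventEq D d) with hF
  suffices (M.intervene hDO d).joint (varEq Y y ∩ F) * M.doJoint X D x d F
      = (M.intervene hDO d).joint F * M.doJoint X D x d (varEq Y y ∩ F) by
    rw [← M.joint_intervene_restrict hDO d, ← M.doJoint_restrict hXO hDO x d,
      Measure.restrict_apply ((hX.inter hY).inter hC), Measure.restrict_apply hC,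
      Measure.restrict_apply (hX.inter hC), Measure.restrict_apply (hY.inter hC)]
    convert this using 3 <;> (rw [hF]; ac_rfl)
  obtain hempty | ⟨ω, hωX, hωC, hωD⟩ := F.eq_empty_or_nonempty
  · simp [hempty]
  obtain rfl : ω X = x := hωX
  obtain rfl := eq_restrict_of_mem_eventEq hωC
  obtain rfl := eq_restrict_of_mem_eventEq hωD
  obtain ⟨W, S, T, hsplit, hXT, hYS⟩ := exists_isFamilySplit_of_eSep hG hsep hXC hXD hYC hYD
  lift W to Finset V using W.toFinite
  lift S to Finset V using S.toFinite
  lift T to Finset V using T.toFinite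
  have hK : ((insert X (C ∪ D) : Finset V) : Set V) ⊆ O := by
    simp [Set.insert_subset_iff, hXO, hCO, hDO]
  rw [hF, ← eventEq_insert_union, M.doJoint_eq_joint_intervene hXO hDO hXD]
  exact joint_inter_mul_joint_intervene _ (isDAG_mono hG (removeInto_le G D))
    (by simpa using hsplit) hK _ _ (by simpa using hXT) _ hY
    ((dependsOn_mem_varEq Y y).mono (by simpa using hYS))

theorem doProb_mul_condProb (hG : G.IsDAG) {X Y : V} {C D : Finset V}
    (hXO : X ∈ O) (hYO : Y ∈ O) (hCO : (C : Set V) ⊆ O) (hDO : (D : Set V) ⊆ O)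
    (hXC : X ∉ C) (hXD : X ∉ D) (hYC : Y ∉ C) (hYD : Y ∉ D)
    (hsep : (G.removeEdge X Y).ESep {X} {Y} C D)
    (x : Ω X) (y : Ω Y) (d : ∀ v : D, Ω v) (c : ∀ v : C, Ω v) :
    M.doProb X Y C D x y d c * condProb (M.intervene hDO d).joint (varEq X x) (eventEq C c)
      = condProb (M.intervene hDO d).joint (varEq X x ∩ varEq Y y) (eventEq C c) := by
  have hC := M.measurableSet_eventEq hCO c
  have := M.isFiniteMeasure_doJoint hG hXO hDO hXD x d
  have hmul := congrArg ENNReal.toReal <|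
    M.joint_intervene_mul_doJoint hG hXO hYO hCO hDO hXC hXD hYC hYD hsep x y d c
  simp only [ENNReal.toReal_mul, ← measureReal_def] at hmul
  rw [doProb, condProb_eq_div hC, condProb_eq_div hC, condProb_eq_div hC, ← mul_div_assoc]
  congr 1
  obtain hzero | hpos := eq_or_ne ((M.doJoint X D x d).real (eventEq C c)) 0
  · have hle := M.restrict_joint_intervene_le_doJoint hXO hDO hXD x d (varEq Y y ∩ eventEq C c)
    rw [Measure.restrict_apply' (M.measurableSet_varEq hXO x), Set.inter_comm, ← Set.inter_assoc,
      measure_mono_null Set.inter_subset_right ((measureReal_eq_zero_iff).1 hzero),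
      nonpos_iff_eq_zero] at hle
    rw [hzero, div_zero, zero_mul, measureReal_def, hle, ENNReal.toReal_zero]
  · rw [div_mul_eq_mul_div, div_eq_iff hpos, hmul, mul_comm]

theorem joint_intervene_inter_of_not_isDescendant (hG : G.IsDAG) {X : V} {C D : Finset V}
    (hXO : X ∈ O) (hCO : (C : Set V) ⊆ O) (hDO : (D : Set V) ⊆ O)
    (hDC : ∀ a ∈ D, ∀ b ∈ C, ¬ G.IsDescendant a b) (hDX : ∀ a ∈ D, ¬ G.IsDescendant a X)
    (x : Ω X) (d : ∀ v : D, Ω v) (c : ∀ v : C, Ω v) :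
    (M.intervene hDO d).joint (varEq X x ∩ eventEq C c) = M.joint (varEq X x ∩ eventEq C c) :=
  M.joint_intervene_of_not_isDescendant hG hDO d (N := insert X C)
    (fun a ha => Set.forall_mem_insert.2 ⟨hDX a ha, hDC a ha⟩)
    ((M.measurableSet_varEq hXO x).inter (M.measurableSet_eventEq hCO c))
    (dependsOn_mem_inter ((dependsOn_mem_varEq X x).mono (by simp))
      ((dependsOn_mem_eventEq C c).mono (Set.subset_insert X C)))

theorem condProb_joint_intervene_of_not_isDescendant (hG : G.IsDAG) {X : V} {C D : Finset V}
    (hXO : X ∈ O) (hCO : (C : Set V) ⊆ O) (hDO : (D : Set V) ⊆ O)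
    (hDC : ∀ a ∈ D, ∀ b ∈ C, ¬ G.IsDescendant a b) (hDX : ∀ a ∈ D, ¬ G.IsDescendant a X)
    (x : Ω X) (d : ∀ v : D, Ω v) (c : ∀ v : C, Ω v) :
    condProb (M.intervene hDO d).joint (varEq X x) (eventEq C c)
      = condProb M.joint (varEq X x) (eventEq C c) := by
  have hC := M.measurableSet_eventEq hCO c
  rw [condProb_eq_div hC, condProb_eq_div hC, measureReal_def, measureReal_def,
    M.joint_intervene_of_not_isDescendant hG hDO d hDC hC (dependsOn_mem_eventEq C c),
    M.joint_intervene_inter_of_not_isDescendant hG hXO hCO hDO hDC hDX, ← measureReal_def,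
    ← measureReal_def]

theorem restrict_cond_joint_le_cond_joint_intervene (hG : G.IsDAG) {C D : Finset V}
    (hCO : (C : Set V) ⊆ O) (hDO : (D : Set V) ⊆ O)
    (hDC : ∀ a ∈ D, ∀ b ∈ C, ¬ G.IsDescendant a b) (d : ∀ v : D, Ω v) (c : ∀ v : C, Ω v) :
    (ProbabilityTheory.cond M.joint (eventEq C c)).restrict (eventEq D d)
      ≤ ProbabilityTheory.cond (M.intervene hDO d).joint (eventEq C c) :=
  restrict_cond_le_cond (M.measurableSet_eventEq hDO d) (M.measurableSet_eventEq hCO c)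
    (M.restrict_joint_le_joint_intervene hDO d)
    (M.joint_intervene_of_not_isDescendant hG hDO d hDC (M.measurableSet_eventEq hCO c)
      (dependsOn_mem_eventEq C c)).symm

theorem condProb_joint_intervene_le_boundDenom (hG : G.IsDAG) {X : V} {C D : Finset V}
    (hCO : (C : Set V) ⊆ O) (hDO : (D : Set V) ⊆ O)
    (hDC : ∀ a ∈ D, ∀ b ∈ C, ¬ G.IsDescendant a b)
    (x : Ω X) (d : ∀ v : D, Ω v) (c : ∀ v : C, Ω v) :
    condProb (M.intervene hDO d).joint (varEq X x) (eventEq C c) ≤ M.boundDenom X C D x d c := by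
  have hD := M.measurableSet_eventEq hDO d
  have hsub := real_sub_le_real_sub
    (M.restrict_cond_joint_le_cond_joint_intervene hG hCO hDO hDC d c) (varEq X x).subset_univ
  rw [measureReal_restrict_apply' hD, measureReal_restrict_apply' hD, Set.univ_inter] at hsub
  have huniv : condProb (M.intervene hDO d).joint Set.univ (eventEq C c) ≤ 1 := condProb_le_one
  simp only [boundDenom, condProb] at huniv ⊢
  linarith

/-- The common form of the two pairs of bounds: they are obtained for `t = boundDenom` and for
`t = p(x | c)`. -/
theorem doProb_mem_Icc_div (hG : G.IsDAG) {X Y : V} {C D : Finset V}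
    (hXO : X ∈ O) (hYO : Y ∈ O) (hCO : (C : Set V) ⊆ O) (hDO : (D : Set V) ⊆ O)
    (hXC : X ∉ C) (hXD : X ∉ D) (hYC : Y ∉ C) (hYD : Y ∉ D)
    (hDC : ∀ a ∈ D, ∀ b ∈ C, ¬ G.IsDescendant a b)
    (hsep : (G.removeEdge X Y).ESep {X} {Y} C D)
    (x : Ω X) (y : Ω Y) (d : ∀ v : D, Ω v) (c : ∀ v : C, Ω v) {t : ℝ} (htpos : 0 < t)
    (ht : condProb (M.intervene hDO d).joint (varEq X x) (eventEq C c) ≤ t) :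
    M.doProb X Y C D x y d c ∈ Set.Icc
      (condProb M.joint (varEq X x ∩ varEq Y y ∩ eventEq D d) (eventEq C c) / t)
      ((condProb M.joint (varEq X x ∩ varEq Y y ∩ eventEq D d) (eventEq C c)
        + (t - condProb M.joint (varEq X x ∩ eventEq D d) (eventEq C c))) / t) := by
  have hle := M.restrict_cond_joint_le_cond_joint_intervene hG hCO hDO hDC d c
  have hmul := M.doProb_mul_condProb hG hXO hYO hCO hDO hXC hXD hYC hYD hsep x y d c
  have hlower := real_div_le hle ht htpos condProb_nonneg hmul
  have hupper := le_real_add_div hle Set.inter_subset_left ht htpos condProb_le_one hmul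
  have hD := M.measurableSet_eventEq hDO d
  rw [measureReal_restrict_apply' hD] at hlower
  rw [measureReal_restrict_apply' hD, measureReal_restrict_apply' hD] at hupper
  exact ⟨hlower, hupper⟩

theorem lowerBound_eq {X Y : V} {C D : Finset V} {x : Ω X} {y : Ω Y} {d : ∀ v : D, Ω v}
    {c : ∀ v : C, Ω v} (hpos : 0 < M.boundDenom X C D x d c) : M.lowerBound X Y C D x y d c
      = condProb M.joint (varEq X x ∩ varEq Y y ∩ eventEq D d) (eventEq C c)
        / M.boundDenom X C D x d c :=
  max_eq_right (div_nonneg condProb_nonneg hpos.le)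

theorem upperBound_eq {X Y : V} {C D : Finset V} {x : Ω X} {y : Ω Y} {d : ∀ v : D, Ω v}
    {c : ∀ v : C, Ω v} (hpos : 0 < M.boundDenom X C D x d c) : M.upperBound X Y C D x y d c
      = (condProb M.joint (varEq X x ∩ varEq Y y ∩ eventEq D d) (eventEq C c)
        + (M.boundDenom X C D x d c
          - condProb M.joint (varEq X x ∩ eventEq D d) (eventEq C c)))
        / M.boundDenom X C D x d c := by
  rw [upperBound, min_eq_left, boundDenom]
  · congr 1
    ring
  · rw [div_le_one hpos, boundDenom, add_sub_assoc, add_sub_assoc]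
    gcongr
    exact condProb_mono (by gcongr; exact Set.inter_subset_left)

theorem tightLowerBound_eq (hG : G.IsDAG) {X Y : V} {C D : Finset V} (hXO : X ∈ O)
    (hCO : (C : Set V) ⊆ O) (x : Ω X) (y : Ω Y) (d : ∀ v : D, Ω v) (c : ∀ v : C, Ω v) :
    M.tightLowerBound X Y C D x y d c
      = condProb M.joint (varEq X x ∩ varEq Y y ∩ eventEq D d) (eventEq C c)
        / condProb M.joint (varEq X x) (eventEq C c) := by
  have := M.isFiniteMeasure_joint hG
  rw [tightLowerBound, condProb_inter_eq_div (M.measurableSet_varEq hXO x)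
    (M.measurableSet_eventEq hCO c), Set.inter_assoc]

theorem tightUpperBound_eq (hG : G.IsDAG) {X Y : V} {C D : Finset V} (hXO : X ∈ O)
    (hCO : (C : Set V) ⊆ O) (x : Ω X) (y : Ω Y) (d : ∀ v : D, Ω v) (c : ∀ v : C, Ω v)
    (hpos : 0 < condProb M.joint (varEq X x) (eventEq C c)) :
    M.tightUpperBound X Y C D x y d c
      = (condProb M.joint (varEq X x ∩ varEq Y y ∩ eventEq D d) (eventEq C c)
        + (condProb M.joint (varEq X x) (eventEq C c)
          - condProb M.joint (varEq X x ∩ eventEq D d) (eventEq C c)))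
        / condProb M.joint (varEq X x) (eventEq C c) := by
  have := M.isFiniteMeasure_joint hG
  have hX := M.measurableSet_varEq hXO x
  have hC := M.measurableSet_eventEq hCO c
  rw [tightUpperBound, condProb_inter_eq_div hX hC, condProb_inter_eq_div hX hC, ← Set.inter_assoc]
  field_simp
  ring

theorem doProb_mem_Icc_lowerBound_upperBound (hG : G.IsDAG) {X Y : V} {C D : Finset V}
    (hXO : X ∈ O) (hYO : Y ∈ O) (hCO : (C : Set V) ⊆ O) (hDO : (D : Set V) ⊆ O)
    (hXC : X ∉ C) (hXD : X ∉ D) (hYC : Y ∉ C) (hYD : Y ∉ D)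
    (hDC : ∀ a ∈ D, ∀ b ∈ C, ¬ G.IsDescendant a b)
    (hsep : (G.removeEdge X Y).ESep {X} {Y} C D)
    {x : Ω X} (y : Ω Y) {d : ∀ v : D, Ω v} {c : ∀ v : C, Ω v}
    (hpos : 0 < M.boundDenom X C D x d c) :
    M.doProb X Y C D x y d c
      ∈ Set.Icc (M.lowerBound X Y C D x y d c) (M.upperBound X Y C D x y d c) := by
  rw [lowerBound_eq _ hpos, upperBound_eq _ hpos]
  exact M.doProb_mem_Icc_div hG hXO hYO hCO hDO hXC hXD hYC hYD hDC hsep x y d c hpos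
    (M.condProb_joint_intervene_le_boundDenom hG hCO hDO hDC x d c)

theorem doProb_mem_Icc_tightLowerBound_tightUpperBound (hG : G.IsDAG) {X Y : V} {C D : Finset V}
    (hXO : X ∈ O) (hYO : Y ∈ O) (hCO : (C : Set V) ⊆ O) (hDO : (D : Set V) ⊆ O)
    (hXC : X ∉ C) (hXD : X ∉ D) (hYC : Y ∉ C) (hYD : Y ∉ D)
    (hDC : ∀ a ∈ D, ∀ b ∈ C, ¬ G.IsDescendant a b) (hDX : ∀ a ∈ D, ¬ G.IsDescendant a X)
    (hsep : (G.removeEdge X Y).ESep {X} {Y} C D)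
    {x : Ω X} (y : Ω Y) (d : ∀ v : D, Ω v) {c : ∀ v : C, Ω v}
    (hpos : M.joint (varEq X x ∩ eventEq C c) ≠ 0) :
    M.doProb X Y C D x y d c
      ∈ Set.Icc (M.tightLowerBound X Y C D x y d c) (M.tightUpperBound X Y C D x y d c) := by
  have := M.isFiniteMeasure_joint hG
  have hpos' := condProb_pos (M.measurableSet_eventEq hCO c) hpos
  rw [M.tightLowerBound_eq hG hXO hCO, M.tightUpperBound_eq hG hXO hCO _ _ _ _ hpos']
  exact M.doProb_mem_Icc_div hG hXO hYO hCO hDO hXC hXD hYC hYD hDC hsep x y d c hpos'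
    (M.condProb_joint_intervene_of_not_isDescendant hG hXO hCO hDO hDC hDX x d c).le

theorem condProb_le_boundDenom (hG : G.IsDAG) {X : V} {C D : Finset V}
    (hXO : X ∈ O) (hCO : (C : Set V) ⊆ O) (hDO : (D : Set V) ⊆ O)
    (hDC : ∀ a ∈ D, ∀ b ∈ C, ¬ G.IsDescendant a b) (hDX : ∀ a ∈ D, ¬ G.IsDescendant a X)
    (x : Ω X) (d : ∀ v : D, Ω v) (c : ∀ v : C, Ω v) :
    condProb M.joint (varEq X x) (eventEq C c) ≤ M.boundDenom X C D x d c :=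
  (M.condProb_joint_intervene_of_not_isDescendant hG hXO hCO hDO hDC hDX x d c).ge.trans
    (M.condProb_joint_intervene_le_boundDenom hG hCO hDO hDC x d c)

theorem boundsDefined_of_not_isDescendant (hG : G.IsDAG) {X : V} {C D : Finset V}
    (hXO : X ∈ O) (hCO : (C : Set V) ⊆ O) (hDO : (D : Set V) ⊆ O) (hXD : X ∉ D)
    (hDC : ∀ a ∈ D, ∀ b ∈ C, ¬ G.IsDescendant a b) (hDX : ∀ a ∈ D, ¬ G.IsDescendant a X)
    {x : Ω X} (d : ∀ v : D, Ω v) {c : ∀ v : C, Ω v}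
    (hpos : M.joint (varEq X x ∩ eventEq C c) ≠ 0) : M.BoundsDefined X C D x d c := by
  have := M.isFiniteMeasure_joint hG
  have hC := M.measurableSet_eventEq hCO c
  refine ⟨mt (measure_mono_null Set.inter_subset_right) hpos, fun hzero => hpos ?_,
    (condProb_pos hC hpos).trans_le (M.condProb_le_boundDenom hG hXO hCO hDO hDC hDX x d c)⟩
  rw [← M.joint_intervene_inter_of_not_isDescendant hG hXO hCO hDO hDC hDX x d c, Set.inter_comm,
    ← Measure.restrict_apply hC]
  exact nonpos_iff_eq_zero.1
    ((M.restrict_joint_intervene_le_doJoint hXO hDO hXD x d _).trans_eq hzero)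

theorem lowerBound_le_tightLowerBound (hG : G.IsDAG) {X Y : V} {C D : Finset V}
    (hXO : X ∈ O) (hCO : (C : Set V) ⊆ O) (hDO : (D : Set V) ⊆ O)
    (hDC : ∀ a ∈ D, ∀ b ∈ C, ¬ G.IsDescendant a b) (hDX : ∀ a ∈ D, ¬ G.IsDescendant a X)
    {x : Ω X} (y : Ω Y) (d : ∀ v : D, Ω v) {c : ∀ v : C, Ω v}
    (hpos : M.joint (varEq X x ∩ eventEq C c) ≠ 0) :
    M.lowerBound X Y C D x y d c ≤ M.tightLowerBound X Y C D x y d c := by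
  have := M.isFiniteMeasure_joint hG
  have hpos' := condProb_pos (M.measurableSet_eventEq hCO c) hpos
  have hle := M.condProb_le_boundDenom hG hXO hCO hDO hDC hDX x d c
  rw [lowerBound_eq _ (hpos'.trans_le hle), M.tightLowerBound_eq hG hXO hCO]
  exact div_le_div_of_nonneg_left condProb_nonneg hpos' hle

theorem tightUpperBound_le_upperBound (hG : G.IsDAG) {X Y : V} {C D : Finset V}
    (hXO : X ∈ O) (hCO : (C : Set V) ⊆ O) (hDO : (D : Set V) ⊆ O)
    (hDC : ∀ a ∈ D, ∀ b ∈ C, ¬ G.IsDescendant a b) (hDX : ∀ a ∈ D, ¬ G.IsDescendant a X)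
    {x : Ω X} (y : Ω Y) (d : ∀ v : D, Ω v) {c : ∀ v : C, Ω v}
    (hpos : M.joint (varEq X x ∩ eventEq C c) ≠ 0) :
    M.tightUpperBound X Y C D x y d c ≤ M.upperBound X Y C D x y d c := by
  have := M.isFiniteMeasure_joint hG
  have hpos' := condProb_pos (M.measurableSet_eventEq hCO c) hpos
  have hle := M.condProb_le_boundDenom hG hXO hCO hDO hDC hDX x d c
  rw [upperBound_eq _ (hpos'.trans_le hle), M.tightUpperBound_eq hG hXO hCO _ _ _ _ hpos']
  exact add_sub_div_le_add_sub_div (condProb_mono (by gcongr; exact Set.inter_subset_left))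
    hpos' hle

end Joint

end CausalModel

theorem theorem3 {V : Type*} [Fintype V] [DecidableEq V] (G : Digraph V) (hG : G.IsDAG)
    (O : Set V) (Ω : V → Type*) [∀ v, MeasurableSpace (Ω v)] (M : CausalModel G O Ω)
    (X Y : V) (hXY : G.Adj X Y) (C D : Finset V)
    (hXO : X ∈ O) (hYO : Y ∈ O) (hCO : (C : Set V) ⊆ O) (hDO : (D : Set V) ⊆ O)
    (hXC : X ∉ C) (hXD : X ∉ D) (hYC : Y ∉ C) (hYD : Y ∉ D) (hCD : Disjoint C D)
    (hdesc : ∀ a ∈ D, ∀ b ∈ C, ¬ G.IsDescendant a b)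
    (hsep : (G.removeEdge X Y).ESep {X} {Y} C D)
    (d : ∀ v : D, Ω v) (c : ∀ v : C, Ω v) :
    (∀ (x : Ω X) (y : Ω Y), M.BoundsDefined X C D x d c →
      M.lowerBound X Y C D x y d c ≤ M.doProb X Y C D x y d c ∧
      M.doProb X Y C D x y d c ≤ M.upperBound X Y C D x y d c) ∧
    (∀ (x₀ x₁ : Ω X) (y₁ : Ω Y), M.BoundsDefined X C D x₀ d c → M.BoundsDefined X C D x₁ d c →
      M.lowerBound X Y C D x₁ y₁ d c - M.upperBound X Y C D x₀ y₁ d c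
        ≤ M.acde X Y C D x₀ x₁ y₁ d c ∧
      M.acde X Y C D x₀ x₁ y₁ d c
        ≤ M.upperBound X Y C D x₁ y₁ d c - M.lowerBound X Y C D x₀ y₁ d c) ∧
    ((∀ a ∈ D, ¬ G.IsDescendant a X) →
      (∀ (x : Ω X) (y : Ω Y), M.joint (varEq X x ∩ eventEq C c) ≠ 0 →
        M.BoundsDefined X C D x d c ∧
        M.lowerBound X Y C D x y d c ≤ M.tightLowerBound X Y C D x y d c ∧
        M.tightLowerBound X Y C D x y d c ≤ M.doProb X Y C D x y d c ∧
        M.doProb X Y C D x y d c ≤ M.tightUpperBound X Y C D x y d c ∧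
        M.tightUpperBound X Y C D x y d c ≤ M.upperBound X Y C D x y d c) ∧
      (∀ (x₀ x₁ : Ω X) (y₁ : Ω Y), M.joint (varEq X x₀ ∩ eventEq C c) ≠ 0 →
        M.joint (varEq X x₁ ∩ eventEq C c) ≠ 0 →
        M.tightLowerBound X Y C D x₁ y₁ d c - M.tightUpperBound X Y C D x₀ y₁ d c
          ≤ M.acde X Y C D x₀ x₁ y₁ d c ∧
        M.acde X Y C D x₀ x₁ y₁ d c
          ≤ M.tightUpperBound X Y C D x₁ y₁ d c - M.tightLowerBound X Y C D x₀ y₁ d c)) := by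
  have loose {x : Ω X} (y : Ω Y) (h : M.BoundsDefined X C D x d c) :=
    M.doProb_mem_Icc_lowerBound_upperBound hG hXO hYO hCO hDO hXC hXD hYC hYD hdesc hsep y h.2.2
  refine ⟨fun x y h => loose y h, fun x₀ x₁ y₁ h₀ h₁ => ?_, fun hX => ?_⟩
  · obtain ⟨hl₀, hu₀⟩ := loose y₁ h₀
    obtain ⟨hl₁, hu₁⟩ := loose y₁ h₁
    exact ⟨sub_le_sub hl₁ hu₀, sub_le_sub hu₁ hl₀⟩
  have tight {x : Ω X} (y : Ω Y) (h : M.joint (varEq X x ∩ eventEq C c) ≠ 0) :=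
    M.doProb_mem_Icc_tightLowerBound_tightUpperBound hG hXO hYO hCO hDO hXC hXD hYC hYD hdesc hX
      hsep y d h
  refine ⟨fun x y h => ⟨?_, ?_, (tight y h).1, (tight y h).2, ?_⟩, fun x₀ x₁ y₁ h₀ h₁ => ?_⟩
  · exact M.boundsDefined_of_not_isDescendant hG hXO hCO hDO hXD hdesc hX d h
  · exact M.lowerBound_le_tightLowerBound hG hXO hCO hDO hdesc hX y d h
  · exact M.tightUpperBound_le_upperBound hG hXO hCO hDO hdesc hX y d h
  · obtain ⟨hl₀, hu₀⟩ := tight y₁ h₀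
    obtain ⟨hl₁, hu₁⟩ := tight y₁ h₁
    exact ⟨sub_le_sub hl₁ hu₀, sub_le_sub hu₁ hl₀⟩
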